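/- Let $d, N$ be natural numbers and $\mathcal H_A=\mathcal H_B=\mathbb C^d$. A property of bipartite pure states is a pair $\mathcal P=(\mathcal P^{\mathrm{yes}},\mathcal P^{\mathrm{no}})$ of disjoint sets of unit vectors of $\mathcal H_A\otimes\mathcal H_B$. It is unitarily invariant on $\mathcal H_B$ if $(I_A\otimes U_B)|\psi\rangle\in\mathcal P^X$ for every $|\psi\rangle\in\mathcal P^X$, every unitary $U$ on $\mathcal H_B$ and $X\in\{\mathrm{yes},\mathrm{no}\}$. A probability distribution $D$ on bipartite pure states is unitarily invariant on $\mathcal H_B$ if $D(S)=D((I_A\otimes U_B)S)$ for every measurable set $S$ of pure states and every unitary $U$ on $\mathcal H_B$. A tester with $N$ samples is an operator $\mathcal T$ on $(\mathcal H_A\otimes\mathcal H_B)^{\otimes N}$ with $0\le\mathcal T\le I$; it is local on $\mathcal H_A$ if $\mathcal T=M_A\otimes I_B$ for an operator $M_A$ on $\mathcal H_A^{\otimes N}$ with $0\le M_A\le I$, where $I_B$ is the identity of $\mathcal H_B^{\otimes N}$. For distributions $D^{\mathrm{yes}},D^{\mathrm{no}}$ on $\mathcal P^{\mathrm{yes}},\mathcal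 P^{\mathrm{no}}$ and $0\le s<c\le1$, a tester $\mathcal T$ with $N$ samples is an average-case $(c,s)$-tester for $\mathcal P$ with respect to $(D^{\mathrm{yes}},D^{\mathrm{no}})$ if $$\mathop{\mathbb E}_{|\psi\rangle\sim D^{\mathrm{yes}}}\operatorname{tr}\!\big(\mathcal T\,|\psi\rangle\langle\psi|^{\otimes N}\big)=c,\qquad \mathop{\mathbb E}_{|\phi\rangle\sim D^{\mathrm{no}}}\operatorname{tr}\!\big(\mathcal T\,|\phi\rangle\langle\phi|^{\otimes N}\big)=s .$$ Suppose $\mathcal P$ is a property of bipartite pure states that is unitarily invariant on $\mathcal H_B$, and $D^{\mathrm{yes}},D^{\mathrm{no}}$ are probability distributions on $\mathcal P^{\mathrm{yes}},\mathcal P^{\mathrm{no}}$ that are unitarily invariant on $\mathcal H_B$. Then: 1. For all $0\le s<c\le 1$, if there is an average-case $(c,s)$-tester $\mathcal T$ for $\mathcal P$ with respect to $(D^{\mathrm{yes}},D^{\mathrm{no}})$ with $N$ samples, then there is a tester $\hat{\mathcal T}$ with $N$ samples that is local on $\mathcal H_A$ and is also an average-case $(c,s)$-tester for $\mathcal P$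 with respect to $(D^{\mathrm{yes}},D^{\mathrm{no}})$. 2. For $\rho=\mathbb E_{|\psi\rangle\sim D^{\mathrm{yes}}}\big[|\psi\rangle\langle\psi|^{\otimes N}\big]$ and $\sigma=\mathbb E_{|\phi\rangle\sim D^{\mathrm{no}}}\big[|\phi\rangle\langle\phi|^{\otimes N}\big]$, $$d_{\mathrm{tr}}(\rho,\sigma)=d_{\mathrm{tr}}(\operatorname{tr}_B[\rho],\operatorname{tr}_B[\sigma]),$$ where $\operatorname{tr}_B$ is the partial trace over $\mathcal H_B^{\otimes N}$ and $d_{\mathrm{tr}}(\rho,\sigma)=\tfrac12\operatorname{tr}|\rho-\sigma|$ with $|X|=\sqrt{X^\dagger X}$. -/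

import Mathlib

open MeasureTheory
open scoped Kronecker ComplexOrder MatrixOrder

namespace LocalTest

noncomputable section

/-- The bipartite space `H_A ⊗ H_B` with `H_A = H_B = ℂ^d`, in its standard basis `|a⟩|b⟩`;
the first index belongs to `A`, the second to `B`. -/
abbrev HAB (d : ℕ) : Type := EuclideanSpace ℂ (Fin d × Fin d)

/-- Bipartite pure states: unit vectors of `H_A ⊗ H_B`, with the Borel σ-algebra. -/
abbrev PureState (d : ℕ) : Type := Metric.sphere (0 : HAB d) 1

/-- Operators on `(H_A ⊗ H_B)^{⊗N}`, as matrices in the standard basis. -/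
abbrev OpAB (d N : ℕ) : Type := Matrix (Fin N → Fin d × Fin d) (Fin N → Fin d × Fin d) ℂ

/-- Operators on `H_A^{⊗N}`, as matrices in the standard basis. -/
abbrev OpA (d N : ℕ) : Type := Matrix (Fin N → Fin d) (Fin N → Fin d) ℂ

/-- The unitary operator `I_A ⊗ U_B` applied to a vector. -/
def applyB {d : ℕ} (U : Matrix.unitaryGroup (Fin d) ℂ) (v : HAB d) : HAB d :=
  Matrix.toEuclideanLin ((1 : Matrix (Fin d) (Fin d) ℂ) ⊗ₖ (U : Matrix (Fin d) (Fin d) ℂ)) v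

theorem norm_applyB {d : ℕ} (U : Matrix.unitaryGroup (Fin d) ℂ) (v : HAB d) :
    ‖applyB U v‖ = ‖v‖ := by
  have hU : (1 : Matrix (Fin d) (Fin d) ℂ) ⊗ₖ (U : Matrix (Fin d) (Fin d) ℂ) ∈
      Matrix.unitaryGroup (Fin d × Fin d) ℂ :=
    Matrix.kronecker_mem_unitary (one_mem _) U.2
  have h1 : ‖applyB U v‖ ^ 2 = ‖v‖ ^ 2 := by
    have h2 : (inner ℂ (applyB U v) (applyB U v) : ℂ) = inner ℂ v v := by
      unfold applyB
      rw [← LinearMap.adjoint_inner_right, ← Matrix.toEuclideanLin_conjTranspose_eq_adjoint,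
        ← LinearMap.comp_apply]
      congr 1
      rw [Matrix.mem_unitaryGroup_iff'] at hU
      ext i
      simp only [LinearMap.comp_apply, Matrix.toEuclideanLin, Matrix.toLpLin_apply, Matrix.mulVec_mulVec]
      rw [← Matrix.star_eq_conjTranspose, hU, Matrix.one_mulVec]
    rw [inner_self_eq_norm_sq_to_K, inner_self_eq_norm_sq_to_K] at h2
    exact_mod_cast h2
  exact (sq_eq_sq₀ (norm_nonneg _) (norm_nonneg _)).mp h1

/-- The action of `I_A ⊗ U_B` on pure states. -/
def actB {d : ℕ} (U : Matrix.unitaryGroup (Fin d) ℂ) (ψ : PureState d) : PureState d :=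
  ⟨applyB U ψ.1, by
    rw [mem_sphere_zero_iff_norm, norm_applyB]
    exact mem_sphere_zero_iff_norm.mp ψ.2⟩

/-- A property of bipartite pure states: a pair of disjoint sets of pure states. -/
structure PureProperty (d : ℕ) where
  yes : Set (PureState d)
  no : Set (PureState d)
  disjoint : Disjoint yes no

/-- The property is unitarily invariant on `H_B`. -/
def PureProperty.UnitarilyInvariantB {d : ℕ} (P : PureProperty d) : Prop :=
  ∀ U : Matrix.unitaryGroup (Fin d) ℂ,
    (∀ ψ ∈ P.yes, actB U ψ ∈ P.yes) ∧ (∀ ψ ∈ P.no, actB U ψ ∈ P.no)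

/-- `D` is a probability distribution on the set `S` of pure states. -/
def IsDistributionOn {d : ℕ} (D : Measure (PureState d)) (S : Set (PureState d)) : Prop :=
  IsProbabilityMeasure D ∧ ∀ᵐ ψ ∂D, ψ ∈ S

/-- The distribution `D` on pure states is unitarily invariant on `H_B`:
every measurable set `S` has the same probability as `(I_A ⊗ U_B) S`. -/
def DistUnitarilyInvariantB {d : ℕ} (D : Measure (PureState d)) : Prop :=
  ∀ S : Set (PureState d), MeasurableSet S →
    ∀ U : Matrix.unitaryGroup (Fin d) ℂ, D S = D (actB U '' S)

/-- The density operator `|ψ⟩⟨ψ|`. -/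
def density {d : ℕ} (ψ : PureState d) : Matrix (Fin d × Fin d) (Fin d × Fin d) ℂ :=
  Matrix.vecMulVec (fun i => ψ.1 i) (fun j => star (ψ.1 j))

/-- The `N`-fold tensor power of a matrix. -/
def tensorPow {ι : Type*} (N : ℕ) (X : Matrix ι ι ℂ) : Matrix (Fin N → ι) (Fin N → ι) ℂ :=
  Matrix.of fun x y => ∏ k, X (x k) (y k)

/-- A tester: an operator `T` with `0 ≤ T ≤ I` in the Löwner order. -/
def IsTester {n : Type*} [Fintype n] [DecidableEq n] (T : Matrix n n ℂ) : Prop :=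
  T.PosSemidef ∧ (1 - T).PosSemidef

/-- The operator `M_A ⊗ I_B` on `(H_A ⊗ H_B)^{⊗N}`, where `M_A` acts on `H_A^{⊗N}` and
`I_B` is the identity of `H_B^{⊗N}`. -/
def tensorIdB {d N : ℕ} (M : OpA d N) : OpAB d N :=
  Matrix.of fun x y =>
    M (fun k => (x k).1) (fun k => (y k).1) *
      (1 : Matrix (Fin N → Fin d) (Fin N → Fin d) ℂ) (fun k => (x k).2) (fun k => (y k).2)

/-- A local tester on `H_A`: `T = M_A ⊗ I_B` with `0 ≤ M_A ≤ I_A`. -/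
def IsLocalTesterA {d N : ℕ} (T : OpAB d N) : Prop :=
  ∃ M : OpA d N, IsTester M ∧ T = tensorIdB M

/-- The probability `tr[T |ψ⟩⟨ψ|^{⊗N}]` that `T` accepts `N` samples of `ψ`. -/
def acceptProb {d N : ℕ} (T : OpAB d N) (ψ : PureState d) : ℝ :=
  (T * tensorPow N (density ψ)).trace.re

/-- `T` is an average-case `(c, s)`-tester with respect to `(Dyes, Dno)` with `N` samples. -/
def IsAverageCaseTester {d N : ℕ} (Dyes Dno : Measure (PureState d)) (c s : ℝ)
    (T : OpAB d N) : Prop :=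
  IsTester T ∧ ∫ ψ, acceptProb T ψ ∂Dyes = c ∧ ∫ ψ, acceptProb T ψ ∂Dno = s

/-- The averaged `N`-copy state `E_{ψ ∼ D} [|ψ⟩⟨ψ|^{⊗N}]`, the expectation taken entrywise. -/
def averageState {d : ℕ} (N : ℕ) (D : Measure (PureState d)) : OpAB d N :=
  Matrix.of fun x y => ∫ ψ, tensorPow N (density ψ) x y ∂D

/-- The partial trace over `H_B^{⊗N}`. -/
def partialTraceB {d N : ℕ} (X : OpAB d N) : OpA d N :=
  Matrix.of fun a a' => ∑ b : Fin N → Fin d, X (fun k => (a k, b k)) (fun k => (a' k, b k))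

/-- The trace distance `(1/2) tr |ρ - σ|`, where `|X|` is the positive square root of `X† X`. -/
def traceDist {n : Type*} [Fintype n] [DecidableEq n] (ρ σ : Matrix n n ℂ) : ℝ :=
  (1 / 2) * (CFC.sqrt (star (ρ - σ) * (ρ - σ))).trace.re

end

end LocalTest

/-! Write the coefficients of a state `ψ` as a matrix `W` with rows indexed by `B`. Then `(I ⊗ U)ψ`
has coefficients `U W`, so it is also `Wᵀ ⊗ I` applied to the unnormalised maximally entangled
vector with coefficients `U`. Let Γ be the Haar average over `U` of the `N`-fold tensor power of the
projector-like operator on that vector (`haarMoment`). Averaging `N` copies of `(I ⊗ U)ψ` gives `T Γ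
T†` with `T = (Wᵀ)^{⊗N} ⊗ I`.

Right invariance of Haar measure makes Γ commute with `V^{⊗N} ⊗ I` for unitary `V`, and a
unitarian-trick argument extends this to every matrix (`commute_tensorPow_of_commute_unitary`). So
`T Γ T† = Γ T T†`, and `T T†` is the reduced state of the `N` copies on `A`, tensored with `I`.
Hence an invariant average state satisfies `ρ = Γ (tr_B ρ ⊗ I)` with commuting factors
(`averageState_eq`, `commute_haarMoment_averageState`), while `tr_B Γ = 1`.

Both claims follow. The local tester is `M = tr_B(√Γ T √Γ)`: it is a tester because `tr_B Γ = 1`,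
and it has the same averages because `ρ = √Γ (tr_B ρ ⊗ I) √Γ`. For the distance, put `X = tr_B ρ -
tr_B σ`; then `|Γ (X ⊗ I)| = Γ (|X| ⊗ I)`, whose trace is `tr |X|`. -/

namespace LocalTest

/-! ### Tensor powers of matrices -/

section TensorPower

variable {ι : Type*} {N : ℕ}

theorem tensorPow_mul [Fintype ι] (X Y : Matrix ι ι ℂ) :
    tensorPow N (X * Y) = tensorPow N X * tensorPow N Y := by
  ext x y
  simp only [tensorPow, Matrix.mul_apply, Matrix.of_apply, Finset.prod_univ_sum,
    Fintype.piFinset_univ, Finset.prod_mul_distrib]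

theorem tensorPow_conjTranspose (X : Matrix ι ι ℂ) :
    tensorPow N X.conjTranspose = (tensorPow N X).conjTranspose := by
  ext x y
  simp [tensorPow, Matrix.conjTranspose_apply]

theorem tensorPow_diagonal [DecidableEq ι] (z : ι → ℂ) :
    tensorPow N (Matrix.diagonal z) = Matrix.diagonal fun x => ∏ k, z (x k) := by
  ext x y
  by_cases h : x = y
  · subst h
    simp [tensorPow]
  · obtain ⟨k, hk⟩ := Function.ne_iff.mp h
    rw [Matrix.diagonal_apply_ne _ h, tensorPow, Matrix.of_apply]
    exact Finset.prod_eq_zero (Finset.mem_univ k) (Matrix.diagonal_apply_ne _ hk)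

theorem tensorPow_one [DecidableEq ι] : tensorPow N (1 : Matrix ι ι ℂ) = 1 := by
  rw [← Matrix.diagonal_one, tensorPow_diagonal]
  simp

end TensorPower

/-! ### The embedding `M ↦ M ⊗ I_B` and the partial trace -/

section PartialTrace

variable {d N : ℕ}

/-- Regrouping `(A × B)^N` as `A^N × B^N`. -/
abbrev splitAB (d N : ℕ) :
    (Fin N → Fin d × Fin d) ≃ (Fin N → Fin d) × (Fin N → Fin d) :=
  Equiv.arrowProdEquivProdArrow (Fin N) (fun _ => Fin d) (fun _ => Fin d)

theorem tensorIdB_eq_submatrix (M : OpA d N) :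
    tensorIdB M = (M ⊗ₖ (1 : OpA d N)).submatrix (splitAB d N) (splitAB d N) := rfl

theorem tensorIdB_mul (M M' : OpA d N) : tensorIdB (M * M') = tensorIdB M * tensorIdB M' := by
  simp only [tensorIdB_eq_submatrix, Matrix.submatrix_mul_equiv, ← Matrix.mul_kronecker_mul, mul_one]

theorem tensorIdB_one : tensorIdB (1 : OpA d N) = 1 := by
  simp [tensorIdB_eq_submatrix]

theorem tensorIdB_sub (M M' : OpA d N) : tensorIdB (M - M') = tensorIdB M - tensorIdB M' := by
  ext x y
  simp [tensorIdB, sub_mul]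

theorem tensorIdB_conjTranspose (M : OpA d N) :
    tensorIdB M.conjTranspose = (tensorIdB M).conjTranspose := by
  rw [tensorIdB_eq_submatrix, tensorIdB_eq_submatrix, Matrix.conjTranspose_submatrix,
    Matrix.conjTranspose_kronecker, Matrix.conjTranspose_one]

theorem posSemidef_tensorIdB {M : OpA d N} (hM : M.PosSemidef) : (tensorIdB M).PosSemidef := by
  rw [tensorIdB_eq_submatrix]
  exact (hM.kronecker Matrix.PosSemidef.one).submatrix _

theorem sum_splitAB {β : Type*} [AddCommMonoid β] (f : (Fin N → Fin d × Fin d) → β) :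
    ∑ x, f x = ∑ a : Fin N → Fin d, ∑ b : Fin N → Fin d, f (fun k => (a k, b k)) := by
  rw [← (splitAB d N).symm.sum_comp, Fintype.sum_prod_type]
  rfl

theorem partialTraceB_tensorIdB_mul (M : OpA d N) (X : OpAB d N) :
    partialTraceB (tensorIdB M * X) = M * partialTraceB X := by
  ext a a'
  simp only [partialTraceB, Matrix.mul_apply, Matrix.of_apply, sum_splitAB, tensorIdB,
    Matrix.one_apply, mul_ite, mul_one, mul_zero, ite_mul, zero_mul, Finset.sum_ite_eq,
    Finset.mem_univ, if_true, Finset.mul_sum]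
  rw [Finset.sum_comm]

theorem trace_partialTraceB (X : OpAB d N) : (partialTraceB X).trace = X.trace := by
  simp only [Matrix.trace, Matrix.diag, sum_splitAB, partialTraceB, Matrix.of_apply]

theorem trace_tensorIdB_mul (M : OpA d N) (X : OpAB d N) :
    (tensorIdB M * X).trace = (M * partialTraceB X).trace := by
  rw [← trace_partialTraceB, partialTraceB_tensorIdB_mul]

theorem partialTraceB_sub (X Y : OpAB d N) :
    partialTraceB (X - Y) = partialTraceB X - partialTraceB Y := by
  ext a a'
  simp [partialTraceB]

theorem posSemidef_partialTraceB {X : OpAB d N} (hX : X.PosSemidef) :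
    (partialTraceB X).PosSemidef := by
  have h : partialTraceB X = ∑ b : Fin N → Fin d,
      X.submatrix (fun a k => (a k, b k)) (fun a k => (a k, b k)) := by
    ext a a'
    simp [partialTraceB, Matrix.sum_apply]
  rw [h]
  exact Matrix.posSemidef_sum _ fun b _ => hX.submatrix _

end PartialTrace

/-! ### Tensor powers of bipartite vectors via coefficient matrices -/

section VecPow

variable {d N : ℕ}

/-- The `N`-fold tensor power of the vector of `H_A ⊗ H_B` with coefficients `W b a`
at `|a⟩|b⟩`. -/
def vecPow (N : ℕ) {d : ℕ} (W : Matrix (Fin d) (Fin d) ℂ) : (Fin N → Fin d × Fin d) → ℂ :=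
  fun x => ∏ k, W (x k).2 (x k).1

/-- The rank-one operator of `vecPow N W`. -/
def vecPowOp (N : ℕ) {d : ℕ} (W : Matrix (Fin d) (Fin d) ℂ) : OpAB d N :=
  Matrix.vecMulVec (vecPow N W) (star (vecPow N W))

/-- The transpose trick: an operator on `A` acts on coefficients from the right, leaving the left
side free for unitaries on `B`. -/
theorem tensorIdB_tensorPow_mulVec_vecPow (V W : Matrix (Fin d) (Fin d) ℂ) :
    (tensorIdB (tensorPow N V)).mulVec (vecPow N W) = vecPow N (W * V.transpose) := by
  ext x
  simp only [Matrix.mulVec, dotProduct, sum_splitAB, tensorIdB, Matrix.of_apply,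
    Matrix.one_apply, mul_ite, mul_one, mul_zero, ite_mul, zero_mul, Finset.sum_ite_eq,
    Finset.mem_univ, if_true, vecPow, Matrix.mul_apply, Matrix.transpose_apply,
    Finset.prod_univ_sum, Fintype.piFinset_univ, tensorPow, ← Finset.prod_mul_distrib]
  exact Finset.sum_congr rfl fun _ _ => Finset.prod_congr rfl fun _ _ => mul_comm _ _

theorem tensorIdB_tensorPow_mul_vecPowOp_mul (V W : Matrix (Fin d) (Fin d) ℂ) :
    tensorIdB (tensorPow N V) * vecPowOp N W * (tensorIdB (tensorPow N V)).conjTranspose =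
      vecPowOp N (W * V.transpose) := by
  rw [vecPowOp, Matrix.mul_vecMulVec, Matrix.vecMulVec_mul, ← Matrix.star_mulVec,
    tensorIdB_tensorPow_mulVec_vecPow, vecPowOp]

theorem partialTraceB_vecPowOp (W : Matrix (Fin d) (Fin d) ℂ) :
    partialTraceB (vecPowOp N W) =
      tensorPow N (W.transpose * W.transpose.conjTranspose) := by
  ext a a'
  simp only [partialTraceB, vecPowOp, Matrix.vecMulVec_apply, vecPow, Matrix.of_apply,
    tensorPow, Matrix.mul_apply, Finset.prod_univ_sum, Fintype.piFinset_univ,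
    Pi.star_apply, star_prod, ← Finset.prod_mul_distrib, Matrix.transpose_apply,
    Matrix.conjTranspose_apply]

/-- The coefficient matrix of a pure state, rows indexed by `B`. -/
def coeffMatrix (ψ : PureState d) : Matrix (Fin d) (Fin d) ℂ :=
  Matrix.of fun b a => ψ.1 (a, b)

theorem tensorPow_density (ψ : PureState d) :
    tensorPow N (density ψ) = vecPowOp N (coeffMatrix ψ) := by
  ext x y
  simp [tensorPow, density, vecPowOp, vecPow, coeffMatrix, Matrix.vecMulVec_apply,
    Finset.prod_mul_distrib]

theorem coeffMatrix_actB (U : Matrix.unitaryGroup (Fin d) ℂ) (ψ : PureState d) :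
    coeffMatrix (actB U ψ) = (U : Matrix (Fin d) (Fin d) ℂ) * coeffMatrix ψ := by
  ext b a
  simp only [coeffMatrix, actB, applyB, Matrix.of_apply, Matrix.toEuclideanLin,
    Matrix.toLpLin_apply, Matrix.mulVec, dotProduct, Fintype.sum_prod_type,
    Matrix.kroneckerMap_apply, Matrix.one_apply, Matrix.mul_apply]
  simp [Finset.sum_ite_eq]

end VecPow

/-! ### From commuting with unitary tensor powers to commuting with all tensor powers -/

section Commutation

variable {d N : ℕ}

theorem commute_tensorIdB_diagonal_iff (Γ : OpAB d N) (z : Fin d → ℂ) :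
    Commute Γ (tensorIdB (tensorPow N (Matrix.diagonal z))) ↔
      ∀ x y, Γ x y * ∏ k, z (y k).1 = (∏ k, z (x k).1) * Γ x y := by
  have h : tensorIdB (tensorPow N (Matrix.diagonal z)) =
      Matrix.diagonal fun x : Fin N → Fin d × Fin d => ∏ k, z (x k).1 := by
    rw [tensorPow_diagonal, tensorIdB_eq_submatrix, ← Matrix.diagonal_one,
      Matrix.diagonal_kronecker_diagonal, Matrix.submatrix_diagonal_equiv]
    simp [Function.comp_def, Equiv.arrowProdEquivProdArrow]
  rw [h, commute_iff_eq, ← Matrix.ext_iff]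
  simp only [Matrix.mul_diagonal, Matrix.diagonal_mul]

theorem diagonal_mem_unitaryGroup {z : Fin d → ℂ} (hz : ∀ i, ‖z i‖ = 1) :
    Matrix.diagonal z ∈ Matrix.unitaryGroup (Fin d) ℂ := by
  rw [Matrix.mem_unitaryGroup_iff, Matrix.star_eq_conjTranspose, Matrix.diagonal_conjTranspose,
    Matrix.diagonal_mul_diagonal, ← Matrix.diagonal_one]
  congr 1
  ext i
  simp [Complex.mul_conj, Complex.normSq_eq_norm_sq, hz]

/-- An operator commuting with the tensor powers of the unitaries commutes with those of all
diagonal matrices: words that no unimodular weight separates have equal letter counts. -/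
theorem commute_diagonal_of_commute_unitary {Γ : OpAB d N}
    (h : ∀ V ∈ Matrix.unitaryGroup (Fin d) ℂ, Commute Γ (tensorIdB (tensorPow N V)))
    (p : Fin d → ℂ) : Commute Γ (tensorIdB (tensorPow N (Matrix.diagonal p))) := by
  rw [commute_tensorIdB_diagonal_iff]
  intro x y
  -- Only nonzero entries matter; for these the `A`-words of `x` and `y` turn out to be permutations
  -- of each other, so every weight product agrees.
  by_cases hxy : Γ x y = 0
  · simp [hxy]
  have hcount : ∀ (w : Fin d → ℂ) (u : Fin N → Fin d × Fin d),
      ∏ k, w (u k).1 = ∏ i, w i ^ (Finset.univ.filter fun k => (u k).1 = i).card := by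
    intro w u
    rw [Finset.prod_comp w (fun k => (u k).1)]
    refine Finset.prod_subset (Finset.subset_univ _) fun i _ hi => ?_
    rw [Finset.card_eq_zero.mpr, pow_zero]
    refine Finset.filter_eq_empty_iff.mpr fun k _ hk => hi ?_
    exact Finset.mem_image.mpr ⟨k, Finset.mem_univ _, hk⟩
  have hsame : ∀ i, (Finset.univ.filter fun k => (x k).1 = i).card =
      (Finset.univ.filter fun k => (y k).1 = i).card := by
    intro i
    -- Letter counts lie in `0, …, N`, so a root of unity of order `N + 1` has distinct powers on
    -- them. Placing it at letter `i`, and `1` elsewhere, isolates the count of `i`.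
    have hζ := Complex.isPrimitiveRoot_exp (N + 1) N.succ_ne_zero
    set ζ := Complex.exp (2 * ↑Real.pi * Complex.I / ((N + 1 : ℕ) : ℂ))
    have hlt : ∀ u : Fin N → Fin d × Fin d,
        (Finset.univ.filter fun k => (u k).1 = i).card < N + 1 := fun u =>
      Nat.lt_succ_of_le ((Finset.card_le_univ _).trans_eq (Fintype.card_fin N))
    refine hζ.pow_inj (hlt x) (hlt y) ?_
    have hV := (commute_tensorIdB_diagonal_iff Γ (Function.update 1 i ζ)).mp
      (h _ (diagonal_mem_unitaryGroup fun j => by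
        rcases eq_or_ne j i with rfl | hj
        · simpa using Complex.norm_eq_one_of_pow_eq_one hζ.pow_eq_one N.succ_ne_zero
        · simp [hj])) x y
    have hprod : ∀ u : Fin N → Fin d × Fin d,
        ∏ k, (Function.update 1 i ζ : Fin d → ℂ) (u k).1 =
          ζ ^ (Finset.univ.filter fun k => (u k).1 = i).card := by
      intro u
      rw [hcount, Finset.prod_eq_single i (fun j _ hj => by simp [hj]) (by simp)]
      simp
    rw [hprod, hprod, mul_comm] at hV
    exact (mul_right_cancel₀ hxy hV).symm
  rw [hcount p x, hcount p y, mul_comm]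
  simp only [hsame]

/-- Diagonalise: the tensor power of `U D U*` factors into unitary and diagonal tensor powers, each
of which commutes with Γ. -/
theorem commute_hermitian_of_commute_unitary {Γ : OpAB d N}
    (h : ∀ V ∈ Matrix.unitaryGroup (Fin d) ℂ, Commute Γ (tensorIdB (tensorPow N V)))
    {H : Matrix (Fin d) (Fin d) ℂ} (hH : H.IsHermitian) :
    Commute Γ (tensorIdB (tensorPow N H)) := by
  rw [hH.spectral_theorem, Unitary.conjStarAlgAut_apply, tensorPow_mul, tensorPow_mul,
    tensorIdB_mul, tensorIdB_mul]
  exact ((h _ hH.eigenvectorUnitary.2).mul_right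
    (commute_diagonal_of_commute_unitary h _)).mul_right (h _ (star hH.eigenvectorUnitary).2)

/-- Write `M = H + iK` with `H`, `K` Hermitian. Each entry of the commutator with `(H + zK)^{⊗N} ⊗
I` is a polynomial in `z` that vanishes for real `z`, hence also at `z = i`. -/
theorem commute_tensorPow_of_commute_unitary {Γ : OpAB d N}
    (h : ∀ V ∈ Matrix.unitaryGroup (Fin d) ℂ, Commute Γ (tensorIdB (tensorPow N V)))
    (M : Matrix (Fin d) (Fin d) ℂ) : Commute Γ (tensorIdB (tensorPow N M)) := by
  set H : Matrix (Fin d) (Fin d) ℂ := (realPart M : Matrix (Fin d) (Fin d) ℂ)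
  set K : Matrix (Fin d) (Fin d) ℂ := (imaginaryPart M : Matrix (Fin d) (Fin d) ℂ)
  have hH : H.IsHermitian := (realPart M).2
  have hK : K.IsHermitian := (imaginaryPart M).2
  have hM : H + Complex.I • K = M := realPart_add_I_smul_imaginaryPart M
  rw [← hM, commute_iff_eq, ← Matrix.ext_iff]
  intro x y
  let t : (Fin N → Fin d × Fin d) → (Fin N → Fin d × Fin d) → Polynomial ℂ := fun u v =>
    (∏ k, (Polynomial.C (H (u k).1 (v k).1) + Polynomial.X * Polynomial.C (K (u k).1 (v k).1))) *
      Polynomial.C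
        ((1 : Matrix (Fin N → Fin d) (Fin N → Fin d) ℂ) (fun k => (u k).2) (fun k => (v k).2))
  have ht : ∀ (z : ℂ) u v, (t u v).eval z = tensorIdB (tensorPow N (H + z • K)) u v := by
    intro z u v
    simp [t, tensorIdB, tensorPow, Polynomial.eval_prod, mul_comm z]
  let q : Polynomial ℂ :=
    ∑ w, Polynomial.C (Γ x w) * t w y - ∑ w, t x w * Polynomial.C (Γ w y)
  have hq : ∀ z : ℂ, q.eval z = (Γ * tensorIdB (tensorPow N (H + z • K))) x y -
      (tensorIdB (tensorPow N (H + z • K)) * Γ) x y := by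
    intro z
    simp [q, Polynomial.eval_finsetSum, ht, Matrix.mul_apply]
  have hq0 : q = 0 := by
    refine Polynomial.eq_zero_of_infinite_isRoot _
      ((Set.infinite_range_of_injective Complex.ofReal_injective).mono ?_)
    rintro _ ⟨r, rfl⟩
    have hr : (H + (r : ℂ) • K).IsHermitian :=
      hH.add (hK.smul (Complex.conj_ofReal r))
    rw [Set.mem_ofPred_eq, Polynomial.IsRoot, hq,
      (commute_hermitian_of_commute_unitary h hr).eq, sub_self]
  have := hq Complex.I
  rw [hq0, Polynomial.eval_zero] at this
  exact (sub_eq_zero.mp this.symm)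

end Commutation

/-! ### Entrywise integrals of matrices -/

section MatrixIntegral

variable {Ω m n : Type*} [MeasurableSpace Ω] [Fintype m] [Fintype n]

/-- The entrywise integral of a matrix-valued function. -/
noncomputable def matrixIntegral (μ : Measure Ω) (F : Ω → Matrix m n ℂ) : Matrix m n ℂ :=
  Matrix.of fun i j => ∫ ω, F ω i j ∂μ

theorem integral_linearMap_comp {μ : Measure Ω} {F : Ω → Matrix m n ℂ}
    (hF : ∀ i j, Integrable (fun ω => F ω i j) μ) (L : Matrix m n ℂ →ₗ[ℂ] ℂ) :
    ∫ ω, L (F ω) ∂μ = L (matrixIntegral μ F) := by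
  classical
  have hL : ∀ X, L X = ∑ i, ∑ j, X i j * L (Matrix.single i j 1) := by
    intro X
    conv_lhs => rw [Matrix.matrix_eq_sum_single X]
    simp only [map_sum]
    refine Finset.sum_congr rfl fun i _ => Finset.sum_congr rfl fun j _ => ?_
    rw [← smul_eq_mul, ← map_smul, Matrix.smul_single, smul_eq_mul, mul_one]
  rw [hL (matrixIntegral μ F), integral_congr_ae (.of_forall fun ω => hL (F ω)),
    integral_finsetSum _ fun i _ => integrable_finsetSum _ fun j _ => (hF i j).mul_const _]
  refine Finset.sum_congr rfl fun i _ => ?_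
  rw [integral_finsetSum _ fun j _ => (hF i j).mul_const _]
  exact Finset.sum_congr rfl fun j _ => integral_mul_const _ _

theorem matrixIntegral_linearMap_comp {p q : Type*} [Fintype p] [Fintype q] {μ : Measure Ω}
    {F : Ω → Matrix m n ℂ} (hF : ∀ i j, Integrable (fun ω => F ω i j) μ)
    (L : Matrix m n ℂ →ₗ[ℂ] Matrix p q ℂ) :
    matrixIntegral μ (fun ω => L (F ω)) = L (matrixIntegral μ F) := by
  ext i j
  exact integral_linearMap_comp hF (Matrix.entryLinearMap ℂ ℂ i j ∘ₗ L)

theorem posSemidef_matrixIntegral {μ : Measure Ω} {F : Ω → Matrix m m ℂ}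
    (hF : ∀ i j, Integrable (fun ω => F ω i j) μ) (h : ∀ ω, (F ω).PosSemidef) :
    (matrixIntegral μ F).PosSemidef := by
  refine .of_dotProduct_mulVec_nonneg ?_ fun x => ?_
  · ext i j
    rw [Matrix.conjTranspose_apply, matrixIntegral, Matrix.of_apply, Matrix.of_apply,
      RCLike.star_def, ← integral_conj]
    exact integral_congr_ae (.of_forall fun ω => (h ω).1.apply i j)
  · let L : Matrix m m ℂ →ₗ[ℂ] ℂ :=
      { toFun := fun X => star x ⬝ᵥ X.mulVec x
        map_add' := fun X Y => by rw [Matrix.add_mulVec, dotProduct_add]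
        map_smul' := fun c X => by rw [Matrix.smul_mulVec, dotProduct_smul]; rfl }
    have hL := integral_linearMap_comp hF L
    change 0 ≤ L (matrixIntegral μ F)
    rw [← hL]
    exact integral_nonneg fun ω => (h ω).dotProduct_mulVec_nonneg x

end MatrixIntegral

/-! ### Haar measure on the unitary group and the moment operator Γ -/

section UnitaryHaar

variable {d N : ℕ}

instance instSecondCountableUnitaryGroup :
    SecondCountableTopology (Matrix.unitaryGroup (Fin d) ℂ) :=
  haveI : SecondCountableTopology (Matrix (Fin d) (Fin d) ℂ) :=
    inferInstanceAs (SecondCountableTopology (Fin d → Fin d → ℂ))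
  TopologicalSpace.Subtype.secondCountableTopology _

instance instCompactUnitaryGroup : CompactSpace (Matrix.unitaryGroup (Fin d) ℂ) := by
  refine isCompact_iff_compactSpace.mp ?_
  have hK : IsCompact (Set.univ.pi fun _ : Fin d => Set.univ.pi fun _ : Fin d =>
      Metric.closedBall (0 : ℂ) 1) :=
    isCompact_univ_pi fun _ => isCompact_univ_pi fun _ => isCompact_closedBall _ _
  refine hK.of_isClosed_subset (isClosed_unitary (R := Matrix (Fin d) (Fin d) ℂ)) ?_
  intro U hU i _ j _
  rw [mem_closedBall_zero_iff]
  exact entry_norm_bound_of_unitary hU i j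

noncomputable instance instMeasurableSpaceUnitaryGroup : MeasurableSpace (Matrix.unitaryGroup (Fin d) ℂ) :=
  borel _

instance instBorelSpaceUnitaryGroup : BorelSpace (Matrix.unitaryGroup (Fin d) ℂ) := ⟨rfl⟩

/-- A right-invariant Haar probability measure on the unitary group. -/
noncomputable def unitaryHaar (d : ℕ) : Measure (Matrix.unitaryGroup (Fin d) ℂ) :=
  (Measure.haarMeasure ⊤).inv

instance instProbabilityUnitaryHaar : IsProbabilityMeasure (unitaryHaar d) := by
  constructor
  rw [unitaryHaar, Measure.inv_apply, Set.inv_univ]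
  exact Measure.haarMeasure_self

/-- Inversion turns the left invariance of `haarMeasure` into right invariance. -/
instance instRightInvariantUnitaryHaar : (unitaryHaar d).IsMulRightInvariant := by
  unfold unitaryHaar
  infer_instance

theorem continuous_vecPowOp_apply {X : Type*} [TopologicalSpace X]
    {W : X → Matrix (Fin d) (Fin d) ℂ} (hW : Continuous W) (x y : Fin N → Fin d × Fin d) :
    Continuous fun t => vecPowOp N (W t) x y := by
  simp only [vecPowOp, vecPow, Matrix.vecMulVec_apply, Pi.star_apply]
  have h : ∀ i j, Continuous fun t => W t i j := fun i j => hW.matrix_elem i j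
  exact (continuous_finsetProd _ fun k _ => h _ _).mul
    (continuous_finsetProd _ fun k _ => h _ _).star

theorem integrable_of_continuous {X : Type*} [TopologicalSpace X] [CompactSpace X]
    [MeasurableSpace X] [OpensMeasurableSpace X] {μ : Measure X} [IsFiniteMeasure μ]
    {f : X → ℂ} (hf : Continuous f) : Integrable f μ :=
  hf.integrable_of_hasCompactSupport (HasCompactSupport.of_compactSpace f)

/-- The Haar average of the `N`-fold tensor power of the maximally entangled operator
`∑ U b a |a b⟩ ⟨a' b'| conj (U b' a')`. -/
noncomputable def haarMoment (d N : ℕ) : OpAB d N :=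
  matrixIntegral (unitaryHaar d) fun U => vecPowOp N (U : Matrix (Fin d) (Fin d) ℂ)

theorem integrable_vecPowOp_coe (x y : Fin N → Fin d × Fin d) :
    Integrable (fun U : Matrix.unitaryGroup (Fin d) ℂ =>
      vecPowOp N (U : Matrix (Fin d) (Fin d) ℂ) x y) (unitaryHaar d) :=
  integrable_of_continuous (continuous_vecPowOp_apply continuous_subtype_val x y)

theorem posSemidef_haarMoment : (haarMoment d N).PosSemidef :=
  posSemidef_matrixIntegral integrable_vecPowOp_coe fun _ =>
    Matrix.posSemidef_vecMulVec_self_star _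

/-- The partial trace as a linear map. -/
noncomputable def partialTraceBLinear (d N : ℕ) : OpAB d N →ₗ[ℂ] OpA d N where
  toFun := partialTraceB
  map_add' X Y := by
    ext a a'
    simp [partialTraceB, Finset.sum_add_distrib]
  map_smul' c X := by
    ext a a'
    simp [partialTraceB, Finset.mul_sum]

/-- The map `M ↦ M ⊗ I_B` as a linear map. -/
noncomputable def tensorIdBLinear (d N : ℕ) : OpA d N →ₗ[ℂ] OpAB d N where
  toFun := tensorIdB
  map_add' X Y := by
    ext x y
    simp [tensorIdB, add_mul]
  map_smul' c X := by
    ext x y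
    simp [tensorIdB, mul_assoc]

theorem transpose_mem_unitaryGroup {V : Matrix (Fin d) (Fin d) ℂ}
    (hV : V ∈ Matrix.unitaryGroup (Fin d) ℂ) : V.transpose ∈ Matrix.unitaryGroup (Fin d) ℂ := by
  rw [Matrix.mem_unitaryGroup_iff]
  have h : star V.transpose = (star V).transpose := rfl
  rw [h, ← Matrix.transpose_mul, Matrix.mem_unitaryGroup_iff'.mp hV, Matrix.transpose_one]

/-- Already true before averaging: the partial trace for a single `U` is `(Uᵀ Uᵀ†)^{⊗N} = 1`. -/
theorem partialTraceB_haarMoment : partialTraceB (haarMoment d N) = 1 := by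
  have h := matrixIntegral_linearMap_comp (integrable_vecPowOp_coe (d := d) (N := N))
    (partialTraceBLinear d N)
  refine h.symm.trans ?_
  have hU : ∀ U : Matrix.unitaryGroup (Fin d) ℂ,
      partialTraceB (vecPowOp N (U : Matrix (Fin d) (Fin d) ℂ)) = 1 := by
    intro U
    rw [partialTraceB_vecPowOp, ← Matrix.star_eq_conjTranspose,
      Matrix.mem_unitaryGroup_iff.mp (transpose_mem_unitaryGroup U.2), tensorPow_one]
  ext i j
  simp [matrixIntegral, partialTraceBLinear, hU]

/-- Left and right multiplication by fixed matrices, as a linear map. -/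
noncomputable def sandwich {m : Type*} [Fintype m] (A B : Matrix m m ℂ) :
    Matrix m m ℂ →ₗ[ℂ] Matrix m m ℂ where
  toFun X := A * X * B
  map_add' X Y := by rw [mul_add, add_mul]
  map_smul' c X := by simp

/-- Conjugating by `V^{⊗N} ⊗ I` replaces `U` by `U Vᵀ` under the integral, which right invariance
absorbs. -/
theorem commute_haarMoment_unitary {V : Matrix (Fin d) (Fin d) ℂ}
    (hV : V ∈ Matrix.unitaryGroup (Fin d) ℂ) :
    Commute (haarMoment d N) (tensorIdB (tensorPow N V)) := by
  have hVt := transpose_mem_unitaryGroup hV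
  set T : OpAB d N := tensorIdB (tensorPow N V) with hT
  have h1 : T * haarMoment d N * T.conjTranspose = haarMoment d N := by
    refine (matrixIntegral_linearMap_comp (integrable_vecPowOp_coe (d := d) (N := N))
      (sandwich T T.conjTranspose)).symm.trans ?_
    ext x y
    have h2 : ∀ U : Matrix.unitaryGroup (Fin d) ℂ,
        sandwich T T.conjTranspose (vecPowOp N (U : Matrix (Fin d) (Fin d) ℂ)) =
          vecPowOp N ((U * ⟨V.transpose, hVt⟩ : Matrix.unitaryGroup (Fin d) ℂ) :
            Matrix (Fin d) (Fin d) ℂ) := fun U =>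
      tensorIdB_tensorPow_mul_vecPowOp_mul V U
    simp only [matrixIntegral, h2, Matrix.of_apply, haarMoment]
    exact integral_mul_right_eq_self
      (fun U : Matrix.unitaryGroup (Fin d) ℂ => vecPowOp N (U : Matrix (Fin d) (Fin d) ℂ) x y) _
  have h3 : T.conjTranspose * T = 1 := by
    rw [hT, ← tensorIdB_conjTranspose, ← tensorPow_conjTranspose, ← tensorIdB_mul,
      ← tensorPow_mul, ← Matrix.star_eq_conjTranspose, Matrix.mem_unitaryGroup_iff'.mp hV,
      tensorPow_one, tensorIdB_one]
  calc haarMoment d N * T = T * haarMoment d N * T.conjTranspose * T := by rw [h1]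
    _ = T * haarMoment d N := by rw [mul_assoc, h3, mul_one]

theorem commute_haarMoment (M : Matrix (Fin d) (Fin d) ℂ) :
    Commute (haarMoment d N) (tensorIdB (tensorPow N M)) :=
  commute_tensorPow_of_commute_unitary (fun _ hV => commute_haarMoment_unitary hV) M

/-- Averaging `N` copies of `(I ⊗ U)|ψ⟩` over `U` gives an operator determined by the reduced
state of `ψ` on `A`. -/
theorem matrixIntegral_tensorPow_density_actB (ψ : PureState d) :
    matrixIntegral (unitaryHaar d) (fun U => tensorPow N (density (actB U ψ))) =
      haarMoment d N * tensorIdB (partialTraceB (tensorPow N (density ψ))) := by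
  set M := (coeffMatrix ψ).transpose with hM
  set T : OpAB d N := tensorIdB (tensorPow N M) with hT
  have h2 : ∀ U : Matrix.unitaryGroup (Fin d) ℂ, tensorPow N (density (actB U ψ)) =
      sandwich T T.conjTranspose (vecPowOp N (U : Matrix (Fin d) (Fin d) ℂ)) := fun U => by
    rw [tensorPow_density, coeffMatrix_actB]
    exact (tensorIdB_tensorPow_mul_vecPowOp_mul M (U : Matrix (Fin d) (Fin d) ℂ)).symm
  simp only [h2]
  rw [matrixIntegral_linearMap_comp integrable_vecPowOp_coe]
  change T * haarMoment d N * T.conjTranspose = _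
  -- Moving `T` to the right of Γ produces `T T†`, the reduced state tensored with the identity.
  rw [← (commute_haarMoment M).eq, mul_assoc, tensorPow_density, partialTraceB_vecPowOp, ← hM,
    tensorPow_mul, tensorIdB_mul, tensorPow_conjTranspose, tensorIdB_conjTranspose]

end UnitaryHaar

/-! ### Average states of unitarily invariant distributions -/

section Average

variable {d N : ℕ}

theorem continuous_coeffMatrix : Continuous (coeffMatrix : PureState d → _) := by
  refine continuous_matrix fun b a => ?_
  simp only [coeffMatrix, Matrix.of_apply]
  fun_prop

theorem continuous_tensorPow_density_apply (x y : Fin N → Fin d × Fin d) :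
    Continuous fun ψ : PureState d => tensorPow N (density ψ) x y := by
  simp only [tensorPow_density]
  exact continuous_vecPowOp_apply continuous_coeffMatrix x y

theorem continuous_tensorPow_density_actB_apply (x y : Fin N → Fin d × Fin d) :
    Continuous fun p : PureState d × Matrix.unitaryGroup (Fin d) ℂ =>
      tensorPow N (density (actB p.2 p.1)) x y := by
  simp only [tensorPow_density, coeffMatrix_actB]
  exact continuous_vecPowOp_apply ((continuous_subtype_val.comp continuous_snd).matrix_mul
    (continuous_coeffMatrix.comp continuous_fst)) x y

theorem integrable_tensorPow_density_apply (D : Measure (PureState d)) [IsFiniteMeasure D]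
    (x y : Fin N → Fin d × Fin d) :
    Integrable (fun ψ : PureState d => tensorPow N (density ψ) x y) D :=
  integrable_of_continuous (continuous_tensorPow_density_apply x y)

theorem coeffMatrix_injective : Function.Injective (coeffMatrix : PureState d → _) := by
  intro ψ φ h
  refine Subtype.ext (PiLp.ext fun x => ?_)
  exact congrFun (congrFun h x.2) x.1

theorem actB_mul (U V : Matrix.unitaryGroup (Fin d) ℂ) (ψ : PureState d) :
    actB (U * V) ψ = actB U (actB V ψ) :=
  coeffMatrix_injective (by simp [coeffMatrix_actB, mul_assoc])

theorem actB_one (ψ : PureState d) : actB 1 ψ = ψ :=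
  coeffMatrix_injective (by simp [coeffMatrix_actB])

theorem continuous_actB (U : Matrix.unitaryGroup (Fin d) ℂ) : Continuous (actB U) := by
  refine Continuous.subtype_mk ?_ _
  exact (LinearMap.continuous_of_finiteDimensional _).comp continuous_subtype_val

theorem map_actB {D : Measure (PureState d)} (hD : DistUnitarilyInvariantB D)
    (U : Matrix.unitaryGroup (Fin d) ℂ) : D.map (actB U) = D := by
  have hm : Measurable (actB U) := (continuous_actB U).measurable
  have hsurj : Function.Surjective (actB U) := fun ψ =>
    ⟨actB U⁻¹ ψ, by rw [← actB_mul, mul_inv_cancel, actB_one]⟩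
  ext S hS
  rw [Measure.map_apply hm hS, hD _ (hm hS) U, Set.image_preimage_eq S hsurj]

/-- A unitarily invariant average state is recovered from its partial trace. -/
theorem averageState_eq {D : Measure (PureState d)} [IsProbabilityMeasure D]
    (hD : DistUnitarilyInvariantB D) :
    averageState N D = haarMoment d N * tensorIdB (partialTraceB (averageState N D)) := by
  let L : OpAB d N →ₗ[ℂ] OpAB d N :=
    LinearMap.mulLeft ℂ (haarMoment d N) ∘ₗ tensorIdBLinear d N ∘ₗ partialTraceBLinear d N
  refine Eq.trans ?_ (matrixIntegral_linearMap_comp (integrable_tensorPow_density_apply D) L)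
  ext x y
  have hinv : ∀ U : Matrix.unitaryGroup (Fin d) ℂ,
      ∫ ψ, tensorPow N (density (actB U ψ)) x y ∂D = ∫ ψ, tensorPow N (density ψ) x y ∂D := by
    intro U
    conv_rhs => rw [← map_actB hD U]
    exact (integral_map (continuous_actB U).aemeasurable
      (continuous_tensorPow_density_apply x y).aestronglyMeasurable).symm
  -- By invariance the inner integral does not depend on `U`, so averaging over `U` changes nothing;
  -- Fubini then moves the Haar average onto each fixed `ψ`.
  calc ∫ ψ, tensorPow N (density ψ) x y ∂D
      = ∫ U, ∫ ψ, tensorPow N (density (actB U ψ)) x y ∂D ∂(unitaryHaar d) := by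
        simp [hinv]
    _ = ∫ ψ, ∫ U, tensorPow N (density (actB U ψ)) x y ∂(unitaryHaar d) ∂D :=
        (integral_integral_swap
          (integrable_of_continuous (continuous_tensorPow_density_actB_apply x y))).symm
    _ = ∫ ψ, L (tensorPow N (density ψ)) x y ∂D := by
        refine integral_congr_ae (.of_forall fun ψ => ?_)
        exact congrFun (congrFun (matrixIntegral_tensorPow_density_actB ψ) x) y

/-- For each `ψ` the reduced state is a tensor power `(M M†)^{⊗N}`, so it commutes with Γ after
tensoring with `I`; commutation is a linear condition and survives integration. -/
theorem commute_haarMoment_averageState {D : Measure (PureState d)} [IsProbabilityMeasure D] :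
    Commute (haarMoment d N) (tensorIdB (partialTraceB (averageState N D))) := by
  have hpt : ∀ ψ : PureState d,
      Commute (haarMoment d N) (tensorIdB (partialTraceB (tensorPow N (density ψ)))) := by
    intro ψ
    rw [tensorPow_density, partialTraceB_vecPowOp]
    exact commute_haarMoment _
  let L : OpAB d N →ₗ[ℂ] OpAB d N :=
    (LinearMap.mulLeft ℂ (haarMoment d N) - LinearMap.mulRight ℂ (haarMoment d N)) ∘ₗ
      tensorIdBLinear d N ∘ₗ partialTraceBLinear d N
  have h := matrixIntegral_linearMap_comp (integrable_tensorPow_density_apply (N := N) D) L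
  have h0 : ∀ ψ : PureState d, L (tensorPow N (density ψ)) = 0 := fun ψ =>
    sub_eq_zero.mpr (hpt ψ).eq
  refine sub_eq_zero.mp (h.symm.trans ?_)
  ext x y
  simp [h0, matrixIntegral]

/-- The average acceptance probability depends only on the average state. -/
theorem integral_acceptProb (D : Measure (PureState d)) [IsProbabilityMeasure D]
    (T : OpAB d N) :
    ∫ ψ, acceptProb T ψ ∂D = (T * averageState N D).trace.re := by
  let L : OpAB d N →ₗ[ℂ] ℂ := Matrix.traceLinearMap _ ℂ ℂ ∘ₗ LinearMap.mulLeft ℂ T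
  have h := integral_linearMap_comp (integrable_tensorPow_density_apply (N := N) D) L
  have hint : Integrable (fun ψ : PureState d => L (tensorPow N (density ψ))) D := by
    refine integrable_of_continuous ?_
    exact L.continuous_of_finiteDimensional.comp
      (continuous_matrix fun x y => continuous_tensorPow_density_apply x y)
  exact (integral_re hint).trans (congrArg Complex.re h)

end Average

/-! ### The local tester and the trace distance -/

section Main

variable {d N : ℕ}

theorem isTester_tensorIdB {M : OpA d N} (hM : IsTester M) : IsTester (tensorIdB M) := by
  refine ⟨posSemidef_tensorIdB hM.1, ?_⟩
  rw [← tensorIdB_one, ← tensorIdB_sub]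
  exact posSemidef_tensorIdB hM.2

/-- The reduced tester on `A`: the adjoint of the recovery channel
`τ ↦ √Γ (τ ⊗ I) √Γ`, with `Γ = haarMoment d N`. -/
noncomputable def reducedTester (T : OpAB d N) : OpA d N :=
  partialTraceB (CFC.sqrt (haarMoment d N) * T * CFC.sqrt (haarMoment d N))

theorem sqrt_haarMoment_mul_self :
    CFC.sqrt (haarMoment d N) * CFC.sqrt (haarMoment d N) = haarMoment d N :=
  CFC.sqrt_mul_sqrt_self _ (Matrix.nonneg_iff_posSemidef.mpr posSemidef_haarMoment)

theorem posSemidef_reducedTester {T : OpAB d N} (hT : T.PosSemidef) :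
    (reducedTester T).PosSemidef := by
  have hS : (CFC.sqrt (haarMoment d N)).conjTranspose = CFC.sqrt (haarMoment d N) :=
    (Matrix.nonneg_iff_posSemidef.mp (CFC.sqrt_nonneg (haarMoment d N))).1
  have h := hT.mul_mul_conjTranspose_same (CFC.sqrt (haarMoment d N))
  rw [hS] at h
  exact posSemidef_partialTraceB h

/-- The map `T ↦ tr_B(√Γ T √Γ)` is positive and, since `tr_B Γ = 1`, unital. -/
theorem isTester_reducedTester {T : OpAB d N} (hT : IsTester T) :
    IsTester (reducedTester T) := by
  refine ⟨posSemidef_reducedTester hT.1, ?_⟩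
  have h : 1 - reducedTester T = reducedTester (1 - T) := by
    rw [reducedTester, reducedTester, mul_sub, sub_mul, mul_one, sqrt_haarMoment_mul_self,
      partialTraceB_sub, partialTraceB_haarMoment]
  rw [h]
  exact posSemidef_reducedTester hT.2

theorem trace_tensorIdB_reducedTester {D : Measure (PureState d)} [IsProbabilityMeasure D]
    (hD : DistUnitarilyInvariantB D) (T : OpAB d N) :
    (tensorIdB (reducedTester T) * averageState N D).trace = (T * averageState N D).trace := by
  set τ := partialTraceB (averageState N D) with hτ
  set S := CFC.sqrt (haarMoment d N) with hS
  -- Functional calculus passes commutation from Γ to its square root.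
  have hcomm : Commute S (tensorIdB τ) := commute_haarMoment_averageState.cfcₙ_nnreal _
  have hrec : averageState N D = S * tensorIdB τ * S := by
    rw [mul_assoc, ← hcomm.eq, ← mul_assoc, sqrt_haarMoment_mul_self]
    exact averageState_eq hD
  rw [trace_tensorIdB_mul, ← hτ, Matrix.trace_mul_comm, reducedTester, ← trace_tensorIdB_mul,
    ← hS]
  calc (tensorIdB τ * (S * T * S)).trace = ((tensorIdB τ * S * T) * S).trace := by
        simp only [mul_assoc]
    _ = (S * tensorIdB τ * S * T).trace := by
        rw [Matrix.trace_mul_comm]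
        simp only [mul_assoc]
    _ = (T * averageState N D).trace := by rw [← hrec, Matrix.trace_mul_comm]

theorem integral_acceptProb_tensorIdB_reducedTester {D : Measure (PureState d)}
    [IsProbabilityMeasure D] (hD : DistUnitarilyInvariantB D) (T : OpAB d N) :
    ∫ ψ, acceptProb (tensorIdB (reducedTester T)) ψ ∂D = ∫ ψ, acceptProb T ψ ∂D := by
  rw [integral_acceptProb, integral_acceptProb, trace_tensorIdB_reducedTester hD]

theorem tensorIdB_sqrt {M : OpA d N} (hM : 0 ≤ M) :
    tensorIdB (CFC.sqrt M) = CFC.sqrt (tensorIdB M) := by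
  refine (CFC.sqrt_unique ?_ ?_).symm
  · rw [← tensorIdB_mul, CFC.sqrt_mul_sqrt_self M hM]
  · exact Matrix.nonneg_iff_posSemidef.mpr
      (posSemidef_tensorIdB (Matrix.nonneg_iff_posSemidef.mp (CFC.sqrt_nonneg M)))

/-- The map `X ↦ Γ (X ⊗ I)` preserves trace norms on the operators `X` for which `X ⊗ I`
commutes with `Γ = haarMoment d N`. -/
theorem trace_sqrt_haarMoment_mul {X : OpA d N}
    (hX : Commute (haarMoment d N) (tensorIdB X)) :
    (CFC.sqrt (star (haarMoment d N * tensorIdB X) * (haarMoment d N * tensorIdB X))).trace =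
      (CFC.sqrt (star X * X)).trace := by
  set Γ := haarMoment d N with hΓ
  have hΓ0 : 0 ≤ Γ := Matrix.nonneg_iff_posSemidef.mpr posSemidef_haarMoment
  have hΓs : star Γ = Γ := posSemidef_haarMoment.1
  have hstar : star (tensorIdB X) = tensorIdB (star X) := (tensorIdB_conjTranspose X).symm
  have hX' : Commute Γ (tensorIdB (star X)) := by
    rw [← hstar]
    have := hX.star_star
    rwa [hΓs] at this
  have hsq : Commute Γ (tensorIdB (star X * X)) := by
    rw [tensorIdB_mul]
    exact hX'.mul_right hX
  have habs : Commute Γ (tensorIdB (CFC.sqrt (star X * X))) := by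
    rw [tensorIdB_sqrt (star_mul_self_nonneg X)]
    exact (hsq.symm.cfcₙ_nnreal _).symm
  -- The right side is nonnegative, being a product of commuting nonnegative operators, and it has
  -- the required square, so it is the square root.
  have hval : CFC.sqrt (star (Γ * tensorIdB X) * (Γ * tensorIdB X)) =
      Γ * tensorIdB (CFC.sqrt (star X * X)) := by
    refine CFC.sqrt_unique ?_ ?_
    · rw [star_mul, hΓs, hstar, habs.symm.mul_mul_mul_comm, ← tensorIdB_mul,
        CFC.sqrt_mul_sqrt_self _ (star_mul_self_nonneg X), ← hX'.eq, hX'.symm.mul_mul_mul_comm,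
        ← tensorIdB_mul]
    · refine habs.mul_nonneg hΓ0 ?_
      exact Matrix.nonneg_iff_posSemidef.mpr (posSemidef_tensorIdB
        (Matrix.nonneg_iff_posSemidef.mp (CFC.sqrt_nonneg _)))
  rw [hval, habs.eq, trace_tensorIdB_mul, partialTraceB_haarMoment, mul_one]

theorem traceDist_averageState {D₁ D₂ : Measure (PureState d)} [IsProbabilityMeasure D₁]
    [IsProbabilityMeasure D₂] (h₁ : DistUnitarilyInvariantB D₁)
    (h₂ : DistUnitarilyInvariantB D₂) :
    traceDist (averageState N D₁) (averageState N D₂) =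
      traceDist (partialTraceB (averageState N D₁)) (partialTraceB (averageState N D₂)) := by
  have hdiff : averageState N D₁ - averageState N D₂ = haarMoment d N *
      tensorIdB (partialTraceB (averageState N D₁) - partialTraceB (averageState N D₂)) := by
    rw [tensorIdB_sub, mul_sub, ← averageState_eq h₁, ← averageState_eq h₂]
  rw [traceDist, traceDist, hdiff, trace_sqrt_haarMoment_mul]
  rw [tensorIdB_sub]
  exact commute_haarMoment_averageState.sub_right commute_haarMoment_averageState

end Main

end LocalTest

theorem theorem3p7 (d N : ℕ) (P : LocalTest.PureProperty d)
    (hP : P.UnitarilyInvariantB)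
    (Dyes Dno : MeasureTheory.Measure (LocalTest.PureState d))
    (hyes : LocalTest.IsDistributionOn Dyes P.yes)
    (hno : LocalTest.IsDistributionOn Dno P.no)
    (hDyes : LocalTest.DistUnitarilyInvariantB Dyes)
    (hDno : LocalTest.DistUnitarilyInvariantB Dno) :
    (∀ c s : ℝ, 0 ≤ s → s < c → c ≤ 1 →
      ∀ T : LocalTest.OpAB d N, LocalTest.IsAverageCaseTester Dyes Dno c s T →
        ∃ T' : LocalTest.OpAB d N,
          LocalTest.IsLocalTesterA T' ∧ LocalTest.IsAverageCaseTester Dyes Dno c s T') ∧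
    LocalTest.traceDist (LocalTest.averageState N Dyes) (LocalTest.averageState N Dno) =
      LocalTest.traceDist
        (LocalTest.partialTraceB (LocalTest.averageState N Dyes))
        (LocalTest.partialTraceB (LocalTest.averageState N Dno)) := by
  have := hyes.1
  have := hno.1
  refine ⟨fun c s _ _ _ T hT => ?_, LocalTest.traceDist_averageState hDyes hDno⟩
  have hM := LocalTest.isTester_reducedTester hT.1
  refine ⟨LocalTest.tensorIdB (LocalTest.reducedTester T), ⟨_, hM, rfl⟩,
    LocalTest.isTester_tensorIdB hM, ?_, ?_⟩
  · rw [LocalTest.integral_acceptProb_tensorIdB_reducedTester hDyes, hT.2.1]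
  · rw [LocalTest.integral_acceptProb_tensorIdB_reducedTester hDno, hT.2.2]
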